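/- Let $(M,\mu)$ be a measure space, let $\mathcal H=L^2(M,\mu;\mathbb R)$, and let $H:D(H)\subset\mathcal H\to\mathcal H$ be a self-adjoint, non-negative operator (for instance, $M$ is a manifold with a Borel measure $\mu$ and $-H$ generates a Markov semigroup with invariant measure $\mu$). Let $\{E(\lambda)\}_{\lambda\ge 0}$ be the resolution of the identity of $H$, i.e. the right-continuous spectral family with $H=\int_{[0,\infty)}\lambda\,\mathrm dE(\lambda)$; thus $E(\{0\})=E(0)$ is the orthogonal projection onto $\ker H$. Put $$\mathcal E(u)=\int_M (H^{1/2}u)^2\,\mathrm d\mu\quad (u\in D(\mathcal E)=D(H^{1/2})),\qquad \mathrm{Var}(u)=\int_M\big(u-E(\{0\})u\big)^2\,\mathrm d\mu\quad(u\in\mathcal H),$$ and give $D(\mathcal E)$ the topology of the graph norm $(\|u\|_{\mathcal H}^2+\mathcal E(u))^{1/2}$. Let $\mathcal X\subset\mathcal H$ be a dense linear subspace with a norm $\|\cdot\|_{\mathcal X}$ (for instance a Hilbert norm) such that, for some constant $c$, $\|u\|_{\mathcal H}\le c\,\|u\|_{\mathcal X}$ for all $u\in\mathcal X$. Assume (Assumption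 A1) that 1. $\mathcal X\cap D(\mathcal E)$ is dense in $D(\mathcal E)$; 2. there are constants $r>0$, $C_1>0$ and $\alpha>-1$ such that for all $u,v\in\mathcal X$ the function $\lambda\mapsto(E(\lambda)u,v)_{\mathcal H}$ is differentiable on $(0,r)$ with continuous derivative, and $$\left|\frac{\mathrm d}{\mathrm d\lambda}(E(\lambda)u,v)_{\mathcal H}\right|\le C_1\lambda^{\alpha}\|u\|_{\mathcal X}\|v\|_{\mathcal X}\qquad\text{for all }\lambda\in(0,r).$$ Then $H$ satisfies the $(\Phi,p)$-weak Poincaré inequality with $p=\frac{2+\alpha}{1+\alpha}\in(1,\infty)$ and $\Phi(u)=\|u\|_{\mathcal X}^2$ for $u\in\mathcal X$, $\Phi(u)=+\infty$ for $u\in\mathcal H\setminus\mathcal X$. That is, $\Phi$ is finite on a dense subset of $D(\mathcal E)$, and, with $\frac1p+\frac1q=1$, there is a constant $C>0$, independent of $u$, such that $$\mathrm{Var}(u)\le C\,\mathcal E(u)^{1/p}\,\Phi(u)^{1/q}\qquad\text{for all }u\in D(\mathcal E),$$ where $0\cdot\infty=0$ on the right-hand side. In particular $\mathrm{Var}(u)\le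 C\,\mathcal E(u)^{1/p}\|u\|_{\mathcal X}^{2/q}$ for all $u\in\mathcal X\cap D(\mathcal E)$. -/

import Mathlib

open MeasureTheory Filter Topology Set
open scoped ENNReal

noncomputable section

namespace WeakPoincare

/-- A resolution of the identity `{E(t)}_{t ≥ 0}` on a real Hilbert space, extended by `E(t) = 0`
for `t < 0`: an increasing, right-continuous (in the strong sense) family of orthogonal projections
with `E(t) → I` strongly as `t → ∞`. In terms of the associated projection-valued measure,
`E(t) = E([0, t])`; in particular `E(0) = E({0})`. -/
structure SpectralFamily (F : Type*) [NormedAddCommGroup F] [InnerProductSpace ℝ F]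
    [CompleteSpace F] where
  proj : ℝ → F →L[ℝ] F
  isStarProjection : ∀ t, IsStarProjection (proj t)
  mul_of_le : ∀ s t, s ≤ t → proj s * proj t = proj s
  right_continuous : ∀ t u, Tendsto (fun s => proj s u) (𝓝[>] t) (𝓝 (proj t u))
  eq_zero_of_neg : ∀ t, t < 0 → proj t = 0
  tendsto_atTop : ∀ u, Tendsto (fun t => proj t u) atTop (𝓝 u)

namespace SpectralFamily

variable {F : Type*} [NormedAddCommGroup F] [InnerProductSpace ℝ F] [CompleteSpace F]

/-- The Riemann-Stieltjes sum of `f` with respect to `E` for the dyadic partition of `[0, 2 ^ n]`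
of mesh `2 ^ (-n)`:
`f(0) E({0}) + ∑ₖ f(k / 2ⁿ) E((k / 2ⁿ, (k + 1) / 2ⁿ])`. -/
def stieltjesSum (E : SpectralFamily F) (f : ℝ → ℝ) (n : ℕ) : F →L[ℝ] F :=
  f 0 • E.proj 0 + ∑ k ∈ Finset.range (4 ^ n),
    f ((k : ℝ) / 2 ^ n) • (E.proj (((k : ℝ) + 1) / 2 ^ n) - E.proj ((k : ℝ) / 2 ^ n))

/-- The spectral integral `∫_{[0,∞)} f(t) dE(t)` of a continuous non-decreasing function
`f ≥ 0`, as an unbounded operator: the strong limit of the Riemann-Stieltjes sums, on the domain of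
all `u` for which this limit exists. (For such `f` the sums are the spectral integrals of step
functions that increase to `f` on `[0, ∞)`, so the domain is `{u | ∫ f(t)² d(E(t)u, u) < ∞}`.) -/
def integral (E : SpectralFamily F) (f : ℝ → ℝ) : F →ₗ.[ℝ] F where
  domain :=
    { carrier := {u | ∃ w, Tendsto (fun n => E.stieltjesSum f n u) atTop (𝓝 w)}
      zero_mem' := ⟨0, by simp⟩
      add_mem' := by
        rintro u v ⟨a, ha⟩ ⟨b, hb⟩
        exact ⟨a + b, by simpa using ha.add hb⟩
      smul_mem' := by
        rintro c u ⟨a, ha⟩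
        exact ⟨c • a, by simpa using ha.const_smul c⟩ }
  toFun :=
    { toFun := fun u => u.2.choose
      map_add' := fun u v => by
        refine tendsto_nhds_unique (u + v).2.choose_spec ?_
        simpa using u.2.choose_spec.add v.2.choose_spec
      map_smul' := fun c u => by
        refine tendsto_nhds_unique (c • u).2.choose_spec ?_
        simpa using u.2.choose_spec.const_smul c }

/-- The defining property of `(∫ f dE) u`. -/
theorem tendsto_integral (E : SpectralFamily F) (f : ℝ → ℝ) (u : (E.integral f).domain) :
    Tendsto (fun n => E.stieltjesSum f n (u : F)) atTop (𝓝 (E.integral f u)) :=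
  u.2.choose_spec

/-- `E` is the resolution of the identity of the operator `H`: `H = ∫_{[0,∞)} t dE(t)`, with
equality of domains. -/
def IsResolutionOf (E : SpectralFamily F) (H : F →ₗ.[ℝ] F) : Prop :=
  E.integral (fun t => t) = H

/-- The square root `H^{1/2} = ∫_{[0,∞)} t^{1/2} dE(t)` of the operator `H` whose resolution of the
identity is `E`. -/
def sqrtOp (E : SpectralFamily F) : F →ₗ.[ℝ] F :=
  E.integral Real.sqrt

end SpectralFamily

section L2

variable {M : Type*} [MeasurableSpace M] {μ : Measure M}

/-- The Dirichlet form `ℰ(u) = ∫_M (H^{1/2} u)² dμ` on its domain `D(ℰ) = D(H^{1/2})`. -/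
def dirichletForm (E : SpectralFamily (Lp ℝ 2 μ)) (u : E.sqrtOp.domain) : ℝ :=
  ∫ x, (E.sqrtOp u : Lp ℝ 2 μ) x ^ 2 ∂μ

/-- The variance `Var(u) = ∫_M (u - E({0}) u)² dμ`. -/
def variance (E : SpectralFamily (Lp ℝ 2 μ)) (u : Lp ℝ 2 μ) : ℝ :=
  ∫ x, (u - E.proj 0 u : Lp ℝ 2 μ) x ^ 2 ∂μ

/-- `A ∩ D(ℰ)` is dense in `D(ℰ)` for the graph-norm topology, given by `‖·‖² + ℰ(·)`. -/
def DenseInFormDomain (E : SpectralFamily (Lp ℝ 2 μ)) (A : Set (Lp ℝ 2 μ)) : Prop :=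
  ∀ u : E.sqrtOp.domain, ∀ ε : ℝ, 0 < ε → ∃ v : E.sqrtOp.domain,
    (v : Lp ℝ 2 μ) ∈ A ∧ ‖((u - v : E.sqrtOp.domain) : Lp ℝ 2 μ)‖ ^ 2
      + dirichletForm E (u - v) < ε

/-- The `(Φ, p)`-weak Poincaré inequality for the operator with resolution of the identity `E`.
Here `p.conjExponent` is the exponent `q` with `1 / p + 1 / q = 1`. -/
structure WeakPoincareInequality (E : SpectralFamily (Lp ℝ 2 μ)) (Φ : Lp ℝ 2 μ → ℝ≥0∞)
    (p : ℝ) : Prop where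
  one_lt : 1 < p
  dense : DenseInFormDomain E {u | Φ u < ∞}
  bound : ∃ C : ℝ, 0 < C ∧ ∀ u : E.sqrtOp.domain,
    ENNReal.ofReal (variance E (u : Lp ℝ 2 μ)) ≤
      ENNReal.ofReal C * ENNReal.ofReal (dirichletForm E u) ^ (1 / p)
        * Φ (u : Lp ℝ 2 μ) ^ (1 / p.conjExponent)

/-- The density-of-states assumption near `0` with exponent `α`, for a subspace `X` of `L²` with
norm `N`. -/
structure DensityOfStatesAssumption (E : SpectralFamily (Lp ℝ 2 μ))
    (X : Submodule ℝ (Lp ℝ 2 μ)) (N : Seminorm ℝ X) (α : ℝ) : Prop where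
  neg_one_lt : -1 < α
  dense : Dense (X : Set (Lp ℝ 2 μ))
  dense_form : DenseInFormDomain E (X : Set (Lp ℝ 2 μ))
  density_bound : ∃ r C₁ : ℝ, 0 < r ∧ 0 < C₁ ∧ ∀ u v : X,
    DifferentiableOn ℝ (fun t => inner ℝ (E.proj t (u : Lp ℝ 2 μ)) (v : Lp ℝ 2 μ)) (Ioo 0 r) ∧
    ContinuousOn (deriv fun t => inner ℝ (E.proj t (u : Lp ℝ 2 μ)) (v : Lp ℝ 2 μ)) (Ioo 0 r) ∧
    ∀ t ∈ Ioo 0 r,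
      |deriv (fun s => inner ℝ (E.proj s (u : Lp ℝ 2 μ)) (v : Lp ℝ 2 μ)) t|
        ≤ C₁ * t ^ α * N u * N v

open scoped Classical in
/-- `Φ(u) = ‖u‖_X²` for `u ∈ X`, and `Φ(u) = ∞` for `u ∉ X`. -/
def normSqOrTop (X : Submodule ℝ (Lp ℝ 2 μ)) (N : Seminorm ℝ X) (u : Lp ℝ 2 μ) : ℝ≥0∞ :=
  if h : u ∈ X then ENNReal.ofReal (N ⟨u, h⟩ ^ 2) else ∞

end L2

end WeakPoincare

end

/-! Split the spectral mass of `u` away from the kernel at a level t > 0: Var(u) = (‖E(t)u‖² -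
‖E(0)u‖²) + ‖u - E(t)u‖² (`variance_eq_add`). For t < r the low part is at most const · t^(1+α)
‖u‖_X², by integrating the density bound (`inner_proj_sub_inner_proj_zero_le`); the high part is at
most ℰ(u)/t by Chebyshev (`mul_norm_sub_proj_sq_le`). For t ≥ r the embedding of X in L² gives the
same bound. Optimizing over t (`le_mul_rpow_of_forall_pos`) yields the exponents (1+α)/(2+α) = 1/p
and 1/(2+α) = 1/q. -/

namespace WeakPoincare

/-! ### Spectral estimates on an abstract Hilbert space. -/

namespace SpectralFamily

variable {F : Type*} [NormedAddCommGroup F] [InnerProductSpace ℝ F] [CompleteSpace F]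

theorem inner_proj_left (E : SpectralFamily F) (t : ℝ) (u v : F) :
    inner ℝ (E.proj t u) v = inner ℝ u (E.proj t v) := by
  have h := (E.isStarProjection t).isSelfAdjoint
  rw [ContinuousLinearMap.isSelfAdjoint_iff'] at h
  conv_lhs => rw [← h]
  exact ContinuousLinearMap.adjoint_inner_left _ _ _

theorem proj_proj (E : SpectralFamily F) {s t : ℝ} (hst : s ≤ t) (u : F) :
    E.proj s (E.proj t u) = E.proj s u :=
  congrArg (fun T : F →L[ℝ] F => T u) (E.mul_of_le s t hst)

theorem inner_proj_proj (E : SpectralFamily F) (s t : ℝ) (u v : F) :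
    inner ℝ (E.proj s u) (E.proj t v) = inner ℝ (E.proj (min s t) u) v := by
  rcases le_total s t with h | h
  · rw [min_eq_left h, inner_proj_left, proj_proj E h, ← inner_proj_left]
  · rw [min_eq_right h, ← inner_proj_left, proj_proj E h]

/-- The distribution function `t ↦ (E(t)u, u)` equals `t ↦ ‖E(t)u‖²`. -/
theorem inner_proj_self (E : SpectralFamily F) (t : ℝ) (u : F) :
    inner ℝ (E.proj t u) u = ‖E.proj t u‖ ^ 2 := by
  rw [← real_inner_self_eq_norm_sq, inner_proj_proj, min_self]

/-- Each increment is the squared norm of (E(t) - E(s))u. -/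
theorem monotone_inner_proj_self (E : SpectralFamily F) (u : F) :
    Monotone fun t => inner ℝ (E.proj t u) u := by
  intro s t hst
  have h : (0 : ℝ) ≤ inner ℝ (E.proj t u - E.proj s u) (E.proj t u - E.proj s u) :=
    real_inner_self_nonneg
  simp only [inner_sub_left, inner_sub_right, inner_proj_proj, min_self, min_eq_left hst,
    min_eq_right hst] at h
  simpa using h

theorem norm_sub_proj_sq (E : SpectralFamily F) (t : ℝ) (u : F) :
    ‖u - E.proj t u‖ ^ 2 = ‖u‖ ^ 2 - inner ℝ (E.proj t u) u := by
  rw [norm_sub_sq_real, ← E.inner_proj_self, real_inner_comm]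
  ring

theorem norm_sub_proj_le (E : SpectralFamily F) (t : ℝ) (u : F) : ‖u - E.proj t u‖ ≤ ‖u‖ := by
  refine le_of_sq_le_sq ?_ (norm_nonneg u)
  rw [norm_sub_proj_sq, inner_proj_self]
  linarith [sq_nonneg ‖E.proj t u‖]

theorem inner_proj_sub_proj (E : SpectralFamily F) (s t : ℝ) (u : F) :
    inner ℝ (E.proj s u) (u - E.proj t u) =
      inner ℝ (E.proj s u) u - inner ℝ (E.proj (min s t) u) u := by
  rw [inner_sub_right, inner_proj_proj]

/-- This is the distribution function of the spectral measure of `u` restricted to (t, ∞); its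
monotonicity makes the weights in the Stieltjes sum nonnegative. -/
theorem monotone_inner_proj_sub_proj (E : SpectralFamily F) (t : ℝ) (u : F) :
    Monotone fun s => inner ℝ (E.proj s u) (u - E.proj t u) := by
  intro a b hab
  simp only [inner_proj_sub_proj]
  have hmono := E.monotone_inner_proj_self u
  rcases le_total b t with h | h
  · rw [min_eq_left h, min_eq_left (hab.trans h)]
    simp
  · rw [min_eq_right h]
    rcases le_total a t with h' | h'
    · rw [min_eq_left h', sub_self]
      exact sub_nonneg.2 (hmono h)
    · rw [min_eq_right h']
      exact sub_le_sub_right (hmono hab) _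

theorem inner_proj_sub_proj_of_le (E : SpectralFamily F) {s t : ℝ} (h : s ≤ t) (u : F) :
    inner ℝ (E.proj s u) (u - E.proj t u) = 0 := by
  rw [inner_proj_sub_proj, min_eq_left h, sub_self]

/-- The part of `u` above the level `t` only sees values `f ≥ f(t - 2⁻ⁿ)`. -/
theorem le_inner_stieltjesSum (E : SpectralFamily F) {f : ℝ → ℝ} (hf : Monotone f) (n : ℕ)
    {t : ℝ} (ht : 0 ≤ t) (u : F) :
    f (t - 1 / 2 ^ n) * inner ℝ (E.proj (2 ^ n) u) (u - E.proj t u) ≤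
      inner ℝ (E.stieltjesSum f n u) (u - E.proj t u) := by
  set g : ℝ → ℝ := fun s => inner ℝ (E.proj s u) (u - E.proj t u) with hg
  have hg0 : g 0 = 0 := E.inner_proj_sub_proj_of_le ht u
  have hsum : inner ℝ (E.stieltjesSum f n u) (u - E.proj t u) =
      ∑ k ∈ Finset.range (4 ^ n),
        f ((k : ℝ) / 2 ^ n) * (g (((k : ℝ) + 1) / 2 ^ n) - g ((k : ℝ) / 2 ^ n)) := by
    have h0 : inner ℝ (E.proj 0 u) (u - E.proj t u) = 0 := hg0
    simp [stieltjesSum, inner_add_left, sum_inner, real_inner_smul_left, h0, hg, inner_sub_left]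
  have htel : ∑ k ∈ Finset.range (4 ^ n),
      (g (((k : ℝ) + 1) / 2 ^ n) - g ((k : ℝ) / 2 ^ n)) = g (2 ^ n) := by
    have h := Finset.sum_range_sub (fun k : ℕ => g ((k : ℝ) / 2 ^ n)) (4 ^ n)
    have h4 : (4 : ℝ) ^ n / 2 ^ n = 2 ^ n := by
      rw [← div_pow]; norm_num
    simpa [h4, hg0] using h
  rw [hsum]
  change _ * g (2 ^ n) ≤ _
  rw [← htel, Finset.mul_sum]
  refine Finset.sum_le_sum fun k _ => ?_
  have hlt : (k : ℝ) / 2 ^ n ≤ ((k : ℝ) + 1) / 2 ^ n := by gcongr; linarith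
  -- Cells below `t` carry no mass. A cell reaching `t` or beyond may straddle it, but its left
  -- endpoint is at least t - 2⁻ⁿ; hence the shift in the bound.
  rcases le_total (((k : ℝ) + 1) / 2 ^ n) t with h | h
  · have h1 : g (((k : ℝ) + 1) / 2 ^ n) = 0 := E.inner_proj_sub_proj_of_le h u
    have h2 : g ((k : ℝ) / 2 ^ n) = 0 := E.inner_proj_sub_proj_of_le (hlt.trans h) u
    simp [h1, h2]
  · refine mul_le_mul_of_nonneg_right (hf ?_)
      (sub_nonneg.2 (E.monotone_inner_proj_sub_proj t u hlt))
    rw [add_div] at h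
    linarith

/-- Chebyshev's inequality `t ‖(I - E(t))u‖² ≤ ‖H^{1/2}u‖²`. -/
theorem mul_norm_sub_proj_sq_le (E : SpectralFamily F) {t : ℝ} (ht : 0 ≤ t)
    (u : E.sqrtOp.domain) : t * ‖(u : F) - E.proj t u‖ ^ 2 ≤ ‖E.sqrtOp u‖ ^ 2 := by
  set w : F := (u : F) - E.proj t u with hw
  have hpow : Tendsto (fun n : ℕ => (2 : ℝ) ^ n) atTop atTop :=
    tendsto_pow_atTop_atTop_of_one_lt one_lt_two
  have hwu : inner ℝ (u : F) w = ‖w‖ ^ 2 := by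
    rw [norm_sub_proj_sq, hw, inner_sub_right, real_inner_self_eq_norm_sq, inner_proj_left]
  have hright : Tendsto (fun n => inner ℝ (E.stieltjesSum Real.sqrt n (u : F)) w) atTop
      (𝓝 (inner ℝ (E.sqrtOp u) w)) :=
    (E.tendsto_integral Real.sqrt u).inner tendsto_const_nhds
  -- The argument of the root may be negative for small `t`; `Real.sqrt` is 0 there, so it is
  -- monotone and continuous on the whole line.
  have hleft : Tendsto
      (fun n : ℕ => √(t - 1 / 2 ^ n) * inner ℝ (E.proj (2 ^ n) (u : F)) w) atTop
      (𝓝 (√t * ‖w‖ ^ 2)) := by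
    refine Tendsto.mul ?_ ?_
    · have h : Tendsto (fun n : ℕ => t - 1 / (2 : ℝ) ^ n) atTop (𝓝 (t - 0)) :=
        tendsto_const_nhds.sub (tendsto_const_nhds.div_atTop hpow)
      rw [sub_zero] at h
      exact (Real.continuous_sqrt.tendsto t).comp h
    · rw [← hwu]
      exact ((E.tendsto_atTop u).comp hpow).inner tendsto_const_nhds
  have hle : √t * ‖w‖ ^ 2 ≤ inner ℝ (E.sqrtOp u) w :=
    le_of_tendsto_of_tendsto' hleft hright fun n =>
      E.le_inner_stieltjesSum Real.sqrt_monotone n ht u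
  have hcs : √t * ‖w‖ ^ 2 ≤ ‖E.sqrtOp u‖ * ‖w‖ := hle.trans (real_inner_le_norm _ _)
  have hroot : √t * ‖w‖ ≤ ‖E.sqrtOp u‖ := by
    rcases (norm_nonneg w).eq_or_lt with h | h
    · rw [← h, mul_zero]; exact norm_nonneg _
    · exact le_of_mul_le_mul_right (by linarith) h
  calc t * ‖w‖ ^ 2 = (√t * ‖w‖) ^ 2 := by rw [mul_pow, Real.sq_sqrt ht]
    _ ≤ ‖E.sqrtOp u‖ ^ 2 := by gcongr

theorem tendsto_inner_proj_self (E : SpectralFamily F) (u : F) (t : ℝ) :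
    Tendsto (fun s => inner ℝ (E.proj s u) u) (𝓝[>] t) (𝓝 (inner ℝ (E.proj t u) u)) :=
  (E.right_continuous t u).inner tendsto_const_nhds

/-- A vector in the kernel of `H^{1/2}` lies in the range of `E({0})`. -/
theorem proj_zero_eq_self (E : SpectralFamily F) (u : E.sqrtOp.domain) (hu : E.sqrtOp u = 0) :
    E.proj 0 (u : F) = u := by
  refine tendsto_nhds_unique (E.right_continuous 0 (u : F)) (tendsto_const_nhds.congr' ?_)
  filter_upwards [self_mem_nhdsWithin] with t (ht : 0 < t)
  have h := E.mul_norm_sub_proj_sq_le ht.le u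
  rw [hu, norm_zero, zero_pow two_ne_zero] at h
  have h' : ‖(u : F) - E.proj t u‖ ^ 2 ≤ 0 := nonpos_of_mul_nonpos_right h ht
  exact sub_eq_zero.1 (norm_eq_zero.1 (pow_eq_zero_iff two_ne_zero |>.1 (h'.antisymm (sq_nonneg _))))

/-- A power bound on the spectral density near `0` integrates to a bound on the spectral measure of
`(0, t]`. -/
theorem inner_proj_sub_inner_proj_zero_le (E : SpectralFamily F) (u : F) {α r A : ℝ}
    (hα : -1 < α) (hA : 0 ≤ A)
    (hd : DifferentiableOn ℝ (fun t => inner ℝ (E.proj t u) u) (Ioo 0 r))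
    (hb : ∀ t ∈ Ioo 0 r, |deriv (fun s => inner ℝ (E.proj s u) u) t| ≤ A * t ^ α)
    {t : ℝ} (ht : t ∈ Ioo 0 r) :
    inner ℝ (E.proj t u) u - inner ℝ (E.proj 0 u) u ≤ A / (1 + α) * t ^ (1 + α) := by
  have hα' : 0 < 1 + α := by linarith
  set f : ℝ → ℝ := fun t => inner ℝ (E.proj t u) u with hf
  have hderiv : ∀ s ∈ Ioo 0 r, HasDerivAt (fun s => A / (1 + α) * s ^ (1 + α) - f s)
      (A * s ^ α - deriv f s) s := by
    intro s hs
    have h1 := (Real.hasDerivAt_rpow_const (x := s) (p := 1 + α) (Or.inl hs.1.ne')).const_mul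
      (A / (1 + α))
    have h2 := (hd.differentiableAt (isOpen_Ioo.mem_nhds hs)).hasDerivAt
    refine (h1.sub h2).congr_deriv ?_
    rw [add_sub_cancel_left]
    field_simp
  -- Comparing with the primitive of A s^α replaces integration of the density, so no behaviour at
  -- the endpoint 0 is needed yet.
  have hmono : MonotoneOn (fun s => A / (1 + α) * s ^ (1 + α) - f s) (Ioo 0 r) := by
    refine monotoneOn_of_deriv_nonneg (convex_Ioo 0 r)
      (fun s hs => (hderiv s hs).continuousAt.continuousWithinAt) ?_ ?_
    · rw [interior_Ioo]
      exact fun s hs => (hderiv s hs).differentiableAt.differentiableWithinAt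
    · rw [interior_Ioo]
      intro s hs
      rw [(hderiv s hs).deriv]
      exact sub_nonneg.2 ((le_abs_self _).trans (hb s hs))
  -- Let s → 0⁺: right-continuity gives E(0), so the atom at 0 is excluded, and the nonnegative
  -- s^(1+α) term is dropped.
  refine le_of_tendsto (tendsto_const_nhds.sub (E.tendsto_inner_proj_self u 0)) ?_
  filter_upwards [Ioo_mem_nhdsGT ht.1] with s hs
  have h := hmono ⟨hs.1, hs.2.trans ht.2⟩ ht hs.2.le
  have h0 : 0 ≤ A / (1 + α) * s ^ (1 + α) :=
    mul_nonneg (div_nonneg hA hα'.le) (Real.rpow_nonneg hs.1.le _)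
  simp only [hf] at h ⊢
  linarith

end SpectralFamily

/-- Optimization over `t` of a bound `K t^{1+α} b + a / t`. -/
theorem le_mul_rpow_of_forall_pos {α K V a b : ℝ} (hα : -1 < α) (ha : 0 ≤ a) (hb : 0 < b)
    (h : ∀ t : ℝ, 0 < t → V ≤ K * t ^ (1 + α) * b + a / t) :
    V ≤ (K + 1) * a ^ ((1 + α) / (2 + α)) * b ^ (1 / (2 + α)) := by
  have hα' : 0 < 1 + α := by linarith
  have hα2 : 0 < 2 + α := by linarith
  rcases ha.eq_or_lt with rfl | ha
  · have hz : V ≤ 0 := by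
      have hlim : Tendsto (fun t : ℝ => K * t ^ (1 + α) * b) (𝓝[>] 0) (𝓝 (K * 0 ^ (1 + α) * b)) :=
        (((Real.continuousAt_rpow_const 0 (1 + α) (Or.inr hα'.le)).tendsto.mono_left
          nhdsWithin_le_nhds).const_mul K).mul_const b
      rw [Real.zero_rpow hα'.ne', mul_zero, zero_mul] at hlim
      refine ge_of_tendsto hlim ?_
      filter_upwards [self_mem_nhdsWithin] with t (ht : 0 < t)
      simpa using h t ht
    rw [Real.zero_rpow (div_pos hα' hα2).ne']
    simpa using hz
  -- The choice t = (a/b)^(1/(2+α)) makes t^(1+α) b equal to a/t, whence the constant K + 1.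
  · have hs : 1 / (2 + α) + (1 + α) / (2 + α) = 1 := by field_simp; ring
    have h1 : ((a / b) ^ (1 / (2 + α))) ^ (1 + α) * b =
        a ^ ((1 + α) / (2 + α)) * b ^ (1 / (2 + α)) := by
      rw [← Real.rpow_mul (div_pos ha hb).le, one_div_mul_eq_div, Real.div_rpow ha.le hb.le,
        div_mul_eq_mul_div, mul_div_assoc]
      congr 1
      rw [div_eq_iff (Real.rpow_pos_of_pos hb _).ne', ← Real.rpow_add hb, hs, Real.rpow_one]
    have h2 : a / (a / b) ^ (1 / (2 + α)) = a ^ ((1 + α) / (2 + α)) * b ^ (1 / (2 + α)) := by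
      rw [Real.div_rpow ha.le hb.le, div_div_eq_mul_div, mul_div_right_comm]
      congr 1
      rw [div_eq_iff (Real.rpow_pos_of_pos ha _).ne', ← Real.rpow_add ha, add_comm, hs,
        Real.rpow_one]
    have h3 := h _ (Real.rpow_pos_of_pos (div_pos ha hb) (1 / (2 + α)))
    rw [mul_assoc, h1, h2] at h3
    linarith

/-! ### Variance and Dirichlet form on L². -/

section L2

variable {M : Type*} [MeasurableSpace M] {μ : Measure M}

theorem integral_sq_eq_norm_sq (u : Lp ℝ 2 μ) : ∫ x, u x ^ 2 ∂μ = ‖u‖ ^ 2 := by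
  rw [← real_inner_self_eq_norm_sq, L2.inner_def]
  simp [pow_two]

theorem dirichletForm_eq (E : SpectralFamily (Lp ℝ 2 μ)) (u : E.sqrtOp.domain) :
    dirichletForm E u = ‖E.sqrtOp u‖ ^ 2 :=
  integral_sq_eq_norm_sq _

theorem variance_eq (E : SpectralFamily (Lp ℝ 2 μ)) (u : Lp ℝ 2 μ) :
    variance E u = ‖u - E.proj 0 u‖ ^ 2 :=
  integral_sq_eq_norm_sq _

theorem variance_eq_add (E : SpectralFamily (Lp ℝ 2 μ)) (u : Lp ℝ 2 μ) (t : ℝ) :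
    variance E u =
      (inner ℝ (E.proj t u) u - inner ℝ (E.proj 0 u) u) + ‖u - E.proj t u‖ ^ 2 := by
  rw [variance_eq, E.norm_sub_proj_sq, E.norm_sub_proj_sq]
  ring

/-- Having one `K` for every t > 0, not only t < r, leaves the later optimization unconstrained. -/
theorem DensityOfStatesAssumption.exists_variance_le {E : SpectralFamily (Lp ℝ 2 μ)}
    {X : Submodule ℝ (Lp ℝ 2 μ)} {N : Seminorm ℝ X} {α : ℝ}
    (hX : DensityOfStatesAssumption E X N α) (hN : ∃ c : ℝ, ∀ u : X, ‖(u : Lp ℝ 2 μ)‖ ≤ c * N u) :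
    ∃ K : ℝ, 0 ≤ K ∧ ∀ (u : E.sqrtOp.domain) (hu : (u : Lp ℝ 2 μ) ∈ X) (t : ℝ), 0 < t →
      variance E (u : Lp ℝ 2 μ) ≤ K * t ^ (1 + α) * N ⟨u, hu⟩ ^ 2 + dirichletForm E u / t := by
  obtain ⟨c, hc⟩ := hN
  obtain ⟨r, C₁, hr, hC₁, hb⟩ := hX.density_bound
  have hα : 0 < 1 + α := by linarith [hX.neg_one_lt]
  have hrα : 0 < r ^ (1 + α) := Real.rpow_pos_of_pos hr _
  -- The first entry serves t < r; the second serves t ≥ r, where Var(u) ≤ c²‖u‖_X² and t^(1+α) ≥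
  -- r^(1+α).
  refine ⟨max (C₁ / (1 + α)) (c ^ 2 / r ^ (1 + α)), le_max_of_le_left (by positivity),
    fun u hu t ht => ?_⟩
  set x : X := ⟨u, hu⟩
  rw [dirichletForm_eq]
  rcases lt_or_ge t r with htr | htr
  · obtain ⟨hd, -, hbd⟩ := hb x x
    have hlow : inner ℝ (E.proj t (u : Lp ℝ 2 μ)) (u : Lp ℝ 2 μ)
        - inner ℝ (E.proj 0 (u : Lp ℝ 2 μ)) (u : Lp ℝ 2 μ)
          ≤ C₁ * N x ^ 2 / (1 + α) * t ^ (1 + α) :=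
      E.inner_proj_sub_inner_proj_zero_le (u : Lp ℝ 2 μ) hX.neg_one_lt (by positivity) hd
        (fun s hs => (hbd s hs).trans_eq (by ring)) ⟨ht, htr⟩
    have hhigh : ‖(u : Lp ℝ 2 μ) - E.proj t u‖ ^ 2 ≤ ‖E.sqrtOp u‖ ^ 2 / t := by
      rw [le_div_iff₀ ht, mul_comm]
      exact E.mul_norm_sub_proj_sq_le ht.le u
    rw [variance_eq_add E _ t]
    refine add_le_add (hlow.trans ?_) hhigh
    calc C₁ * N x ^ 2 / (1 + α) * t ^ (1 + α) = C₁ / (1 + α) * t ^ (1 + α) * N x ^ 2 := by ring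
      _ ≤ _ := by gcongr; exact le_max_left _ _
  · have hvar : variance E (u : Lp ℝ 2 μ) ≤ (c * N x) ^ 2 := by
      rw [variance_eq]
      have := (E.norm_sub_proj_le 0 (u : Lp ℝ 2 μ)).trans (hc x)
      gcongr
    have hnn : 0 ≤ ‖E.sqrtOp u‖ ^ 2 / t := by positivity
    calc variance E (u : Lp ℝ 2 μ) ≤ (c * N x) ^ 2 := hvar
      _ = c ^ 2 / r ^ (1 + α) * r ^ (1 + α) * N x ^ 2 := by field_simp
      _ ≤ max (C₁ / (1 + α)) (c ^ 2 / r ^ (1 + α)) * t ^ (1 + α) * N x ^ 2 := by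
        gcongr
        exact le_max_right _ _
      _ ≤ _ := le_add_of_nonneg_right hnn

theorem variance_eq_zero_of_dirichletForm_eq_zero (E : SpectralFamily (Lp ℝ 2 μ))
    (u : E.sqrtOp.domain) (hu : dirichletForm E u = 0) : variance E (u : Lp ℝ 2 μ) = 0 := by
  rw [dirichletForm_eq] at hu
  rw [variance_eq, E.proj_zero_eq_self u (by simpa using hu)]
  simp

theorem setOf_normSqOrTop_lt_top (X : Submodule ℝ (Lp ℝ 2 μ)) (N : Seminorm ℝ X) :
    {u | normSqOrTop X N u < ∞} = (X : Set (Lp ℝ 2 μ)) := by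
  ext u
  by_cases hu : u ∈ X <;> simp [normSqOrTop, hu]

end L2

end WeakPoincare

/-- `H` is a non-negative self-adjoint operator on the real Hilbert space `L²(M, μ)` and `E` is its
resolution of the identity. `X` is a subspace of `L²(M, μ)` with a norm `N` that is stronger than
the `L²` norm (so that the seminorm `N` is a norm); it may, but need not, be a Hilbert norm. -/
theorem theorem1p1 {M : Type*} [MeasurableSpace M] (μ : MeasureTheory.Measure M)
    (H : MeasureTheory.Lp ℝ 2 μ →ₗ.[ℝ] MeasureTheory.Lp ℝ 2 μ)
    (hH : IsSelfAdjoint H)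
    (hH_nonneg : ∀ u : H.domain, 0 ≤ inner ℝ (H u) (u : MeasureTheory.Lp ℝ 2 μ))
    (E : WeakPoincare.SpectralFamily (MeasureTheory.Lp ℝ 2 μ))
    (hE : E.IsResolutionOf H)
    (X : Submodule ℝ (MeasureTheory.Lp ℝ 2 μ)) (N : Seminorm ℝ X)
    (hN : ∃ c : ℝ, ∀ u : X, ‖(u : MeasureTheory.Lp ℝ 2 μ)‖ ≤ c * N u)
    (α : ℝ) (hX : WeakPoincare.DensityOfStatesAssumption E X N α) :
    WeakPoincare.WeakPoincareInequality E (WeakPoincare.normSqOrTop X N)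
      ((2 + α) / (1 + α)) := by
  have hα : 0 < 1 + α := by linarith [hX.neg_one_lt]
  have hα2 : 0 < 2 + α := by linarith
  have hp : 1 / ((2 + α) / (1 + α)) = (1 + α) / (2 + α) := one_div_div _ _
  have hq : 1 / Real.conjExponent ((2 + α) / (1 + α)) = 1 / (2 + α) := by
    have h : (2 + α) / (1 + α) - 1 = 1 / (1 + α) := by field_simp; ring
    rw [Real.conjExponent, h]
    field_simp
  refine ⟨(one_lt_div hα).2 (by linarith), ?_, ?_⟩
  · rw [WeakPoincare.setOf_normSqOrTop_lt_top]
    exact hX.dense_form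
  obtain ⟨K, hK, hbound⟩ := hX.exists_variance_le hN
  refine ⟨K + 1, by positivity, fun u => ?_⟩
  rw [hp, hq]
  have hnn : 0 ≤ WeakPoincare.dirichletForm E u := by
    rw [WeakPoincare.dirichletForm_eq]
    positivity
  -- Zero energy is treated apart, since the right side may then read 0 · ∞ = 0.
  rcases hnn.eq_or_lt with h0 | hpos
  · rw [WeakPoincare.variance_eq_zero_of_dirichletForm_eq_zero E u h0.symm]
    simp
  by_cases hu : (u : MeasureTheory.Lp ℝ 2 μ) ∈ X
  · rw [WeakPoincare.normSqOrTop, dif_pos hu]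
    set x : X := ⟨u, hu⟩
    rw [ENNReal.ofReal_rpow_of_pos hpos, ENNReal.ofReal_rpow_of_nonneg (sq_nonneg _) (by positivity),
      ← ENNReal.ofReal_mul (by positivity), ← ENNReal.ofReal_mul (by positivity)]
    refine ENNReal.ofReal_le_ofReal ?_
    -- The optimization needs ‖u‖_X > 0; otherwise `hN` forces u = 0.
    rcases (apply_nonneg N x).eq_or_lt with hx | hx
    · obtain ⟨c, hc⟩ := hN
      have hz : (u : MeasureTheory.Lp ℝ 2 μ) = 0 := by
        have h := hc x
        rw [← hx, mul_zero] at h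
        exact norm_le_zero_iff.1 h
      have hv : WeakPoincare.variance E (u : MeasureTheory.Lp ℝ 2 μ) = 0 := by
        simp [WeakPoincare.variance_eq, hz]
      rw [hv]
      positivity
    · exact WeakPoincare.le_mul_rpow_of_forall_pos hX.neg_one_lt hpos.le (by positivity)
        (hbound u hu)
  · have htop : WeakPoincare.normSqOrTop X N (u : MeasureTheory.Lp ℝ 2 μ) = ⊤ := dif_neg hu
    rw [htop, ENNReal.top_rpow_of_pos (by positivity), ENNReal.mul_top]
    · exact le_top
    · refine mul_ne_zero ?_ ?_
      · simp only [ne_eq, ENNReal.ofReal_eq_zero, not_le]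
        positivity
      · rw [ENNReal.ofReal_rpow_of_pos hpos]
        simp only [ne_eq, ENNReal.ofReal_eq_zero, not_le]
        positivity
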